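/- **Setting.** Let $G=(V,E)$ be a finite connected simple graph with at least two vertices, cellularly embedded in a closed oriented surface; let $S$ be the surface obtained by removing the interiors (discs) of some (possibly none) of the faces ("holes"). The remaining faces are the plaquettes $p$; $F$ is their number, $b_2=1$ if there are no holes and $b_2=0$ otherwise, and $b_1=|E|-|V|-F+1+b_2$ is the first Betti number of $S$. Fix a proper edge coloring $\alpha$ of $G$. At a vertex $j$ of valence $z(j)$ put $2k_j$ Hermitian matrices $\Gamma_j^\mu$ of size $2^{k_j}$ with $\{\Gamma_j^\mu,\Gamma_j^\nu\}=2\delta_{\mu\nu}$, where $2k_j=z(j)$ or $z(j)+1$ is even; distinct colors at $j$ label distinct matrices, and all operators act on $\bigotimes_j\mathbb C^{2^{k_j}}$. Put $K_{ij}=\Gamma_i^{\alpha(ij)}\Gamma_j^{\alpha(ij)}$, $\Gamma_j^{\rm ch}=\mathrm i^{k_j}\Gamma_j^1\cdots\Gamma_j^{2k_j}$, $H=-\sum_{\langle ij\rangle}J_{ij}K_{ij}$ with $J_{ij}\in\mathbb R$, and let $\mathcal L$ be the Lindbladian with Hamiltonian $H$ and jump operators $L_j=\sqrt{\gamma_j}\,\Gamma_j^{\rm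 ch}$, $\gamma_j\ge 0$. For a closed walk $C$ on $G$ let $W_C$ be the ordered product of the $K_{ij}$ along $C$; $W_p$ is the product along the oriented boundary of $p$. A *dual path* is a nonempty path on the dual graph inside $S$ that is closed or, if $S$ has boundary, leads from boundary to boundary. For $a=1,\dots,b_1$ let $\ell_a$ be closed walks on $G$ and $\tilde\ell_a$ dual paths such that $\ell_a$ and $\tilde\ell_b$ intersect an odd number of times if $a=b$ and an even number of times otherwise. Put $\overline X_a=W_{\ell_a}$, $\overline Z_a=\prod_{\langle ij\rangle\in\tilde\ell_a}\Gamma_i^{\alpha(ij)}$ (in the order of the path), where for each crossed edge $i$ is an arbitrarily chosen one of its two endpoints. **Algebra.** For all $a,b$ and all choices of endpoints, $$[\overline X_a,\overline X_b]=0,\qquad \overline X_a\overline Z_b=(-1)^{\delta_{ab}}\overline Z_b\overline X_a,\qquad \overline Z_a\overline Z_b=(-1)^{n_{ab}}\overline Z_b\overline Z_a,$$ where $n_{ab}$ is the number of pairs consisting of a crossing of $\tilde\ell_a$ and a crossing of $\tilde\ell_b$ at two different edges with the same chosen endpoint; so $[\overline Z_a,\overline Z_b]=0$ whenever the endpoints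 are chosen such that $n_{ab}$ is even. Each $\overline X_a$ is unitary and commutes with $H$, all $L_j$ and all $L_j^\dagger$ (a strong symmetry of $\mathcal L$). **Steady states.** Let $w=(w_p,w_{\ell_a})$ be any system of simultaneous eigenvalues of all $W_p$ and $W_{\ell_a}$ (they are $\pm1$ or $\pm\mathrm i$), and let $\rho_w=P_w/\mathrm{Tr}\,P_w$ with $P_w=\prod_a\frac{1+w_{\ell_a}^*W_{\ell_a}}2\prod_p\frac{1+w_p^*W_p}2$ the projector onto that sector. Then $\rho_w$ is a density matrix, $\mathcal L(\rho_w)=0$, and $\overline X_a\rho_w=\rho_w\overline X_a=w_{\ell_a}\rho_w$ for all $a$. **Strong-to-weak spontaneous symmetry breaking.** Let $x\ne y$ be vertices, and let $\overline Z_a(x)$, $\overline Z_a(y)$ be defined like $\overline Z_a$ (with any choice of endpoints) on dual paths that can be continuously deformed to $\tilde\ell_a$ in $S$ and that cross an edge at $x$, respectively at $y$. Then $\overline X_a^\dagger\,\overline Z_a(x)\,\overline X_a=-\overline Z_a(x)$, and likewise for $y$. The Rényi-1 correlator vanishes, $$\mathrm{Tr}[\rho_w\overline Z_a(x)\overline Z_a(y)]=0,$$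 unless the gamma matrices $\Gamma_i^{\alpha(e)}$ that occur an odd number of times in $\overline Z_a(x)$ and $\overline Z_a(y)$ together are exactly those at both ends of all edges $e$ of a subgraph with all degrees even (possibly empty), i.e. unless $\overline Z_a(x)\overline Z_a(y)$ is, up to a phase, a product of edge terms along closed paths. (In particular it vanishes if some edge is crossed an odd number of times by one of the two paths and an even number of times by the other.) The normalized Rényi-2 correlator is always $$\frac{\mathrm{Tr}[\rho_w\overline Z_a(x)\overline Z_a(y)\,\rho_w\,\overline Z_a(y)^\dagger\overline Z_a(x)^\dagger]}{\mathrm{Tr}[\rho_w^2]}=1,$$ and if $\overline Z_a(x)$, $\overline Z_a(y)$ are multiplied by phases that make them Hermitian, this also holds with the daggers omitted. Thus the one-form strong symmetry $W_{\ell_a}$ is spontaneously broken to a weak one. -/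

import Mathlib

open scoped Matrix ComplexOrder

noncomputable section

namespace GammaMatrix

/-- The finite orbit of `d` under `f`, listed as `d, f d, f (f d), …`, each element once. -/
def orbitList {D : Type*} (f : D → D) (d : D) : List D :=
  (List.range (Function.minimalPeriod f d)).map fun m => f^[m] d

section Surface

variable {V : Type*} {G : SimpleGraph V}

/-- A cellular embedding of a graph into a closed oriented surface, given by its rotation system:
for every vertex, the cyclic order of the darts (oriented edges) leaving that vertex. -/
structure RotationSystem (G : SimpleGraph V) where
  next : Equiv.Perm G.Dart
  fst_next : ∀ d, (next d).fst = d.fst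
  sameCycle : ∀ d e : G.Dart, d.fst = e.fst → next.SameCycle d e

namespace RotationSystem

variable (R : RotationSystem G)

/-- Face tracing: traverse the dart `d`, then leave its head along the next dart in the rotation.
The orbits are the oriented boundary walks of the faces. -/
def faceStep : Equiv.Perm G.Dart :=
  (Function.Involutive.toPerm SimpleGraph.Dart.symm SimpleGraph.Dart.symm_involutive).trans R.next

/-- The faces of the embedding. -/
def Face : Type _ := Quotient (Equiv.Perm.SameCycle.setoid R.faceStep)

/-- The face whose boundary walk contains the dart `d`; the face on the other side of the edge of
`d` is `face d.symm`. -/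
def face (d : G.Dart) : R.Face := Quotient.mk _ d

/-- The elementary plaquettes of the surface that is obtained from the closed surface by removing
the faces in `holes`, each of which leaves one boundary component. -/
def Plaquette (holes : Set R.Face) : Type _ := {f : R.Face // f ∉ holes}

/-- The boundary walk of a face, from some starting dart. -/
def faceBoundary (f : R.Face) : List G.Dart := orbitList R.faceStep (Quotient.out f)

instance [Finite V] : Finite G.Dart :=
  Finite.of_injective (fun d : G.Dart => d.toProd) SimpleGraph.Dart.toProd_injective

instance [Finite V] : Finite R.Face := inferInstanceAs (Finite (Quotient _))

instance [Finite V] (holes : Set R.Face) : Finite (R.Plaquette holes) :=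
  inferInstanceAs (Finite {f : R.Face // f ∉ holes})

instance [Finite V] (holes : Set R.Face) : Fintype (R.Plaquette holes) := Fintype.ofFinite _

open Classical in
/-- The first Betti number `b₁` of the surface, from its Euler characteristic
`N - E + F = 1 - b₁ + b₂`, where `F` counts the plaquettes and `b₂` is `1` if the surface is closed
and `0` otherwise. -/
def bettiOne (holes : Set R.Face) : ℕ :=
  (Nat.card G.edgeSet + 1 + if holes = ∅ then 1 else 0) -
    (Nat.card V + Nat.card (R.Plaquette holes))

/-- A path on the dual graph is recorded by the darts that it crosses; it crosses `d` from
`face d` to `face d.symm`. `DualStep d e` says that `e` can be crossed right after `d`: the face in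
between is the same, and belongs to the surface. -/
def DualStep (holes : Set R.Face) (d e : G.Dart) : Prop :=
  R.face d.symm = R.face e ∧ R.face e ∉ holes

/-- Nonempty paths on the dual graph that are closed, or that lead from a boundary component of the
surface to a boundary component. On a closed surface only the former exist. -/
def IsDualPath (holes : Set R.Face) (p : List G.Dart) : Prop :=
  p ≠ [] ∧ p.IsChain (R.DualStep holes) ∧
    ((∀ d ∈ p.getLast?, ∀ e ∈ p.head?, R.DualStep holes d e) ∨
      ((∀ e ∈ p.head?, R.face e ∈ holes) ∧ (∀ d ∈ p.getLast?, R.face d.symm ∈ holes)))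

/-- Elementary deformations of a path on the dual graph: change of the starting point of a closed
path, insertion of a backtracking pair of crossings, and pushing the path across a vertex of the
graph (a plaquette of the dual graph), i.e. replacing `a` by `b` where `a` followed by the reverse
of `b` runs once around a vertex. -/
inductive DualMove : List G.Dart → List G.Dart → Prop
  | rotate (l₁ l₂ : List G.Dart) : DualMove (l₁ ++ l₂) (l₂ ++ l₁)
  | backtrack (l₁ l₂ : List G.Dart) (d : G.Dart) : DualMove (l₁ ++ l₂) (l₁ ++ [d, d.symm] ++ l₂)
  | push (l₁ l₂ a b : List G.Dart) (d : G.Dart)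
      (h : (a ++ (b.map SimpleGraph.Dart.symm).reverse).IsRotated (orbitList R.next d)) :
      DualMove (l₁ ++ a ++ l₂) (l₁ ++ b ++ l₂)

/-- Continuous deformation (free homotopy; ends on the boundary may slide along it) of paths on the
dual graph, inside the surface. -/
def DualDeformable (holes : Set R.Face) : List G.Dart → List G.Dart → Prop :=
  Relation.EqvGen fun p q => R.IsDualPath holes p ∧ R.IsDualPath holes q ∧ R.DualMove p q

end RotationSystem

/-- A path on the dual graph together with the choice, for each crossed edge, of one of its two
endpoints. -/
abbrev DualString (G : SimpleGraph V) := List (G.Dart × Bool)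

/-- The chosen endpoint of a crossed edge. -/
def site (q : G.Dart × Bool) : V := if q.2 then q.1.fst else q.1.snd

/-- The underlying path on the dual graph. -/
def DualString.path (s : DualString G) : List G.Dart := s.map Prod.fst

/-- The path crosses an edge at the vertex `x`. -/
def DualString.PassesThrough (s : DualString G) (x : V) : Prop := ∃ q ∈ s, x ∈ q.1.edge

open Classical in
/-- The number of intersections of a walk on the graph with a path on the dual graph. -/
def intersections {u v : V} (l : G.Walk u v) (s : DualString G) : ℕ :=
  (s.map fun q => l.edges.count q.1.edge).sum

open Classical in
/-- How often the edge `e` is crossed with chosen endpoint `v`. -/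
def DualString.multiplicity (s : DualString G) (v : V) (e : Sym2 V) : ℕ :=
  s.countP fun q => site q = v ∧ q.1.edge = e

open Classical in
/-- The number of pairs of crossings of `s` and `t` in which two different edges meet at the same
chosen endpoint. -/
def clashes (s t : DualString G) : ℕ :=
  (s.map fun q => t.countP fun r => site q = site r ∧ q.1.edge ≠ r.1.edge).sum

open Classical in
/-- The gamma matrices that occur an odd number of times in the two strings together are exactly
those of an even subgraph `C` (a disjoint union of closed paths, possibly empty), both ends of each
edge of `C` included. In this case the product of the two string operators is, up to a phase, a
product of edge terms along closed paths. -/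
def DifferByFlux (s t : DualString G) : Prop :=
  ∃ C : Finset (Sym2 V), (↑C ⊆ G.edgeSet) ∧ (∀ v, Even (C.filter fun e => v ∈ e).card) ∧
    ∀ v, ∀ e ∈ G.edgeSet, v ∈ e →
      (Odd (s.multiplicity v e + t.multiplicity v e) ↔ e ∈ C)

end Surface

section Model

variable {V : Type*} [Fintype V] [DecidableEq V] (G : SimpleGraph V) [DecidableRel G.Adj]

/-- Half the number of gamma matrices at a vertex of valence `z`: `2k = z` if `z` is even and
`2k = z + 1` if `z` is odd. -/
def halfRank (v : V) : ℕ := (G.degree v + 1) / 2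

/-- A gamma-matrix model on a graph: a proper edge coloring, and at each vertex `v` a set of `2k`
Euclidean gamma matrices of size `2^k`, together with a labelling of gamma matrices at `v` by the
colors of the edges at `v`. -/
structure Model where
  color : Sym2 V → Fin (G.maxDegree + 1)
  color_rule : ∀ u v w, G.Adj u v → G.Adj u w → color s(u, v) = color s(u, w) → v = w
  gamma : ∀ v, Fin (2 * halfRank G v) → Matrix (Fin (2 ^ halfRank G v)) (Fin (2 ^ halfRank G v)) ℂ
  gamma_hermitian : ∀ v μ, (gamma v μ).IsHermitian
  gamma_clifford : ∀ v μ ν,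
    gamma v μ * gamma v ν + gamma v ν * gamma v μ = if μ = ν then 2 else 0
  label : ∀ v, Fin (G.maxDegree + 1) → Fin (2 * halfRank G v)
  label_injective : ∀ u v w, G.Adj u v → G.Adj u w →
    label u (color s(u, v)) = label u (color s(u, w)) → color s(u, v) = color s(u, w)

/-- The index set of the product basis of the Hilbert space `⨂ v, ℂ^(2^k(v))`. -/
abbrev Conf := ∀ v, Fin (2 ^ halfRank G v)

/-- Operators on the Hilbert space. -/
abbrev Op := Matrix (Conf G) (Conf G) ℂ

variable {G}

/-- The operator that acts as `A` on the tensor factor of `v` and as the identity on the others. -/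
def onSite (v : V) (A : Matrix (Fin (2 ^ halfRank G v)) (Fin (2 ^ halfRank G v)) ℂ) : Op G :=
  fun x y => if ∀ u, u ≠ v → x u = y u then A (x v) (y v) else 0

namespace Model

variable (M : Model G)

/-- `Γ_v^α` for a color `α`. -/
def Gam (v : V) (α : Fin (G.maxDegree + 1)) : Op G := onSite v (M.gamma v (M.label v α))

/-- The chiral element `i^k Γ_v^1 ⋯ Γ_v^{2k}`. -/
def chiral (v : V) : Op G :=
  Complex.I ^ halfRank G v • (List.ofFn fun μ => onSite v (M.gamma v μ)).prod

/-- The edge term `K_ij = Γ_i^α Γ_j^α`, where `α` is the color of the edge. -/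
def edgeTerm (d : G.Dart) : Op G := M.Gam d.fst (M.color d.edge) * M.Gam d.snd (M.color d.edge)

/-- `H = - ∑ J_ij K_ij` over the edges (each edge carries two darts). -/
def hamiltonian (J : Sym2 V → ℝ) : Op G :=
  -((1 / 2 : ℂ) • ∑ d : G.Dart, (J d.edge : ℂ) • M.edgeTerm d)

/-- The jump operators `√γ_j Γ_j^ch`. -/
def jump (γ : V → ℝ) (j : V) : Op G := (Real.sqrt (γ j) : ℂ) • M.chiral j

/-- The Lindbladian. -/
def lindbladian (J : Sym2 V → ℝ) (γ : V → ℝ) (ρ : Op G) : Op G :=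
  -(Complex.I • (M.hamiltonian J * ρ - ρ * M.hamiltonian J)) +
    ∑ j, (M.jump γ j * ρ * (M.jump γ j)ᴴ -
      (1 / 2 : ℂ) • ((M.jump γ j)ᴴ * M.jump γ j * ρ + ρ * ((M.jump γ j)ᴴ * M.jump γ j)))

/-- The string operator `∏ K_ij` along a list of consecutive edges. -/
def fluxString (l : List G.Dart) : Op G := (l.map M.edgeTerm).prod

/-- The string operator `∏ Γ_i^α` along a path on the dual graph, with `i` the chosen endpoint and
`α` the color of the crossed edge. -/
def dualOp (s : DualString G) : Op G :=
  (s.map fun q => M.Gam (site q) (M.color q.1.edge)).prod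

section Sectors

variable (R : RotationSystem G) (holes : Set R.Face) {n : ℕ} {base : Fin n → V}
  (l : ∀ a, G.Walk (base a) (base a))

/-- The flux through an elementary plaquette. -/
def plaquetteFlux (p : R.Plaquette holes) : Op G := M.fluxString (R.faceBoundary p.1)

/-- The logical operator `X̄_a`: the flux along the `a`-th closed walk. -/
def logicalX (a : Fin n) : Op G := M.fluxString (l a).darts

/-- `(w, w')` is a strong-flux configuration: a system of simultaneous eigenvalues of all the
fluxes through plaquettes and along the given closed walks. -/
def IsFluxConfig (w : R.Plaquette holes → ℂ) (w' : Fin n → ℂ) : Prop :=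
  ∃ ψ : Conf G → ℂ, ψ ≠ 0 ∧ (∀ p, M.plaquetteFlux R holes p *ᵥ ψ = w p • ψ) ∧
    ∀ a, M.logicalX l a *ᵥ ψ = w' a • ψ

/-- The projector `∏_ℓ (1 + w_ℓ^* W_ℓ)/2 ∏_p (1 + w_p^* W_p)/2` onto a flux sector; the factors
commute. The eigenvalues are `±1` or `±i`; the complex conjugation makes the factor of an
eigenvalue `w = ±i` the projector onto that eigenvalue. -/
def sectorProjector (w : R.Plaquette holes → ℂ) (w' : Fin n → ℂ) : Op G :=
  (List.ofFn fun a => (1 / 2 : ℂ) • (1 + star (w' a) • M.logicalX l a)).prod *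
    ((Finset.univ : Finset (R.Plaquette holes)).toList.map fun p =>
      (1 / 2 : ℂ) • (1 + star (w p) • M.plaquetteFlux R holes p)).prod

/-- The steady state `ρ_w`: the normalized projector onto the flux sector. -/
def steadyState (w : R.Plaquette holes → ℂ) (w' : Fin n → ℂ) : Op G :=
  (M.sectorProjector R holes l w w').trace⁻¹ • M.sectorProjector R holes l w w'

end Sectors

end Model

end Model

end GammaMatrix

end

/-! Every sign is a parity count. The edge term of `d` anticommutes with the gamma matrix of an edge
`e` at `v` exactly when `v ∈ d.edge` and `d.edge ≠ e`, so a product of edge terms contributes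
incidences at `v` plus traversals of `e` (`signCommute_fluxString_Gam`). Closed walks and face
boundaries meet every vertex evenly (`IsCyclic`), so for them only the traversals of `e` remain,
whichever endpoint is chosen. Hence cyclic fluxes commute with edge terms, with the Hamiltonian,
with the chiral elements and with one another, and their sign with a dual string is the parity of
the crossings.

Topology enters through two facts. Deforming a dual path keeps its crossing parity with a cyclic
list, because the star of a vertex meets such a list evenly (`even_crossings_iff_of_dualMove`). A
dual path crosses the boundary of a plaquette evenly, because it leaves every plaquette it enters
(`even_crossings_faceBoundary`).

Consequently Z(x)Z(y) commutes with every flux in the sector projector, hence with the steady state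
ρ; being unitary, it drops out of the Rényi-2 correlator. For Rényi-1, expand the projector into
fluxes W_L of cyclic lists. The trace of W_L Z(x)Z(y) vanishes if some gamma matrix or chiral
element anticommutes with this operator; otherwise the gamma matrices of odd multiplicity are those
of the edges that `L` traverses oddly (`Model.odd_multiplicity_iff_of_trace_ne_zero`).

A flux W is unitary with W² = ±1, so the factors (1 + w^*W)/2 are commuting orthogonal projections
that fix the given eigenvector. Their product is a nonzero projection commuting with the Hamiltonian
and with the jumps, which are multiples of unitaries; this makes ρ stationary. -/

namespace GammaMatrix

/-! ### Single-site operators and the Clifford relations -/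

section OnSite

variable {V : Type*} [Fintype V] [DecidableEq V] {G : SimpleGraph V} [DecidableRel G.Adj]

theorem onSite_mul (v : V) (A B : Matrix (Fin (2 ^ halfRank G v)) (Fin (2 ^ halfRank G v)) ℂ) :
    onSite v A * onSite v B = onSite v (A * B) := by
  ext x y
  rw [Matrix.mul_apply]
  by_cases h : ∀ u, u ≠ v → x u = y u
  · have hr : onSite v (A * B) x y = ∑ t, A (x v) t * B t (y v) := by
      simp only [onSite, if_pos h, Matrix.mul_apply]
    rw [hr]
    symm
    -- Only intermediate configurations that agree with `x` away from `v` contribute; they are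
    -- parametrized by their value `t` at `v`.
    refine Finset.sum_of_injOn (fun t => Function.update x v t)
      (fun s _ t _ hst => Function.update_injective x v hst) (fun _ _ => Finset.mem_coe.2 (Finset.mem_univ _)) ?_ ?_
    · intro z _ hz
      have : ¬ ∀ u, u ≠ v → x u = z u := by
        intro hx
        apply hz
        refine ⟨z v, by simp, ?_⟩
        ext u
        by_cases hu : u = v
        · subst hu; simp
        · simp [Function.update_of_ne hu, hx u hu]
      simp only [onSite, if_neg this, zero_mul]
    · intro t _
      have h1 : ∀ u, u ≠ v → x u = Function.update x v t u := fun u hu => by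
        rw [Function.update_of_ne hu]
      have h2 : ∀ u, u ≠ v → Function.update x v t u = y u := fun u hu => by
        rw [Function.update_of_ne hu, h u hu]
      simp only [onSite, if_pos h1, if_pos h2, Function.update_self]
  · rw [show onSite v (A * B) x y = 0 by simp only [onSite, if_neg h]]
    refine Finset.sum_eq_zero fun z _ => ?_
    by_cases h1 : ∀ u, u ≠ v → x u = z u
    · have h2 : ¬ ∀ u, u ≠ v → z u = y u := fun h2 => h fun u hu => (h1 u hu).trans (h2 u hu)
      simp only [onSite, if_neg h2, mul_zero]
    · simp only [onSite, if_neg h1, zero_mul]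

/-- A single intermediate configuration survives, `x` with its value at `u` replaced by that of `y`.
The resulting formula is symmetric in the two sites, which gives commutation. -/
theorem onSite_mul_apply_of_ne {u v : V} (huv : u ≠ v)
    (A : Matrix (Fin (2 ^ halfRank G u)) (Fin (2 ^ halfRank G u)) ℂ)
    (B : Matrix (Fin (2 ^ halfRank G v)) (Fin (2 ^ halfRank G v)) ℂ) (x y : Conf G) :
    (onSite u A * onSite v B) x y =
      if ∀ w, w ≠ u → w ≠ v → x w = y w then A (x u) (y u) * B (x v) (y v) else 0 := by
  rw [Matrix.mul_apply, Finset.sum_eq_single (Function.update x u (y u))]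
  · have h1 : ∀ w, w ≠ u → x w = Function.update x u (y u) w := fun w hw => by
      rw [Function.update_of_ne hw]
    simp only [onSite, if_pos h1, Function.update_self, Function.update_of_ne huv.symm]
    by_cases h : ∀ w, w ≠ u → w ≠ v → x w = y w
    · rw [if_pos h, if_pos]
      intro w hw
      by_cases hwu : w = u
      · subst hwu; simp
      · rw [Function.update_of_ne hwu, h w hwu hw]
    · rw [if_neg h, if_neg, mul_zero]
      intro h'
      apply h
      intro w hwu hwv
      rw [← h' w hwv, Function.update_of_ne hwu]
  · intro z _ hz
    by_cases h1 : ∀ w, w ≠ u → x w = z w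
    · have h2 : ¬ ∀ w, w ≠ v → z w = y w := by
        intro h2
        apply hz
        ext w
        by_cases hwu : w = u
        · subst hwu; rw [h2 w huv]; simp
        · rw [Function.update_of_ne hwu, h1 w hwu]
      simp only [onSite, if_neg h2, mul_zero]
    · simp only [onSite, if_neg h1, zero_mul]
  · simp

theorem onSite_commute_of_ne {u v : V} (huv : u ≠ v)
    (A : Matrix (Fin (2 ^ halfRank G u)) (Fin (2 ^ halfRank G u)) ℂ)
    (B : Matrix (Fin (2 ^ halfRank G v)) (Fin (2 ^ halfRank G v)) ℂ) :
    Commute (onSite u A) (onSite v B) := by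
  ext x y
  rw [onSite_mul_apply_of_ne huv, onSite_mul_apply_of_ne huv.symm]
  by_cases h : ∀ w, w ≠ u → w ≠ v → x w = y w
  · rw [if_pos h, if_pos fun w hv hu => h w hu hv, mul_comm]
  · rw [if_neg h, if_neg fun h' => h fun w hu hv => h' w hv hu]

theorem onSite_one (v : V) : onSite (G := G) v 1 = 1 := by
  ext x y
  by_cases h : x = y
  · subst h; simp [onSite]
  · rw [Matrix.one_apply_ne h]
    by_cases h1 : ∀ u, u ≠ v → x u = y u
    · have : x v ≠ y v := fun h2 => h (funext fun u => by
        by_cases hu : u = v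
        · subst hu; exact h2
        · exact h1 u hu)
      simp only [onSite, if_pos h1, Matrix.one_apply_ne this]
    · simp only [onSite, if_neg h1]

theorem onSite_neg (v : V) (A : Matrix (Fin (2 ^ halfRank G v)) (Fin (2 ^ halfRank G v)) ℂ) :
    onSite v (-A) = -onSite v A := by
  ext x y
  by_cases h : ∀ u, u ≠ v → x u = y u
  · simp only [onSite, if_pos h, Matrix.neg_apply]
  · simp only [onSite, if_neg h, Matrix.neg_apply, neg_zero]

theorem onSite_conjTranspose (v : V)
    (A : Matrix (Fin (2 ^ halfRank G v)) (Fin (2 ^ halfRank G v)) ℂ) :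
    (onSite v A)ᴴ = onSite v Aᴴ := by
  ext x y
  rw [Matrix.conjTranspose_apply]
  by_cases h : ∀ u, u ≠ v → x u = y u
  · simp only [onSite, if_pos h, if_pos fun u hu => (h u hu).symm, Matrix.conjTranspose_apply]
  · have h' : ¬ ∀ u, u ≠ v → y u = x u := fun h' => h fun u hu => (h' u hu).symm
    simp only [onSite, if_neg h, if_neg h', star_zero]

omit [DecidableEq V] in
theorem Model.gamma_mul_self (M : Model G) (v : V) (μ : Fin (2 * halfRank G v)) :
    M.gamma v μ * M.gamma v μ = 1 := by
  have h := M.gamma_clifford v μ μ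
  rw [if_pos rfl, ← two_mul] at h
  have h2 : (2 : ℂ) • (M.gamma v μ * M.gamma v μ) = (2 : ℂ) • 1 := by
    rw [two_smul, two_smul, ← two_mul, h, one_add_one_eq_two]
  exact smul_right_injective _ two_ne_zero h2

theorem Model.onSite_gamma_mul_self (M : Model G) (v : V) (μ : Fin (2 * halfRank G v)) :
    onSite v (M.gamma v μ) * onSite v (M.gamma v μ) = 1 := by
  rw [onSite_mul, M.gamma_mul_self, onSite_one]

theorem Model.onSite_gamma_mem_unitary (M : Model G) (v : V) (μ : Fin (2 * halfRank G v)) :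
    onSite v (M.gamma v μ) ∈ Matrix.unitaryGroup (Conf G) ℂ := by
  rw [Matrix.mem_unitaryGroup_iff, Matrix.star_eq_conjTranspose, onSite_conjTranspose,
    (M.gamma_hermitian v μ).eq, M.onSite_gamma_mul_self]

theorem Model.onSite_gamma_anticomm (M : Model G) (v : V) {μ ν : Fin (2 * halfRank G v)}
    (h : μ ≠ ν) : onSite v (M.gamma v μ) * onSite v (M.gamma v ν) =
      -(onSite v (M.gamma v ν) * onSite v (M.gamma v μ)) := by
  have hc := M.gamma_clifford v μ ν
  rw [if_neg h] at hc
  rw [onSite_mul, onSite_mul, eq_neg_of_add_eq_zero_left hc, onSite_neg]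

end OnSite

/-! ### Orbits of a permutation -/

section OrbitList

variable {D : Type*}

theorem nodup_orbitList (f : D → D) (d : D) : (orbitList f d).Nodup := by
  refine List.Nodup.map_on (fun m hm n hn h => ?_) List.nodup_range
  exact Function.iterate_injOn_Iio_minimalPeriod (List.mem_range.1 hm) (List.mem_range.1 hn) h

theorem mem_orbitList [Finite D] (f : Equiv.Perm D) (d e : D) :
    e ∈ orbitList f d ↔ f.SameCycle d e := by
  constructor
  · intro h
    obtain ⟨m, -, rfl⟩ := List.mem_map.1 h
    exact ⟨m, by rw [zpow_natCast, Equiv.Perm.iterate_eq_pow]⟩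
  · intro h
    obtain ⟨m, -, rfl⟩ := h.exists_pow_eq'
    have hd : d ∈ Function.periodicPts f :=
      Function.mem_periodicPts.2 ⟨orderOf f, orderOf_pos f, by
        rw [Function.IsPeriodicPt, Function.IsFixedPt, Equiv.Perm.iterate_eq_pow, pow_orderOf_eq_one,
          Equiv.Perm.one_apply]⟩
    refine List.mem_map.2 ⟨m % Function.minimalPeriod f d,
      List.mem_range.2 (Nat.mod_lt _ (Function.minimalPeriod_pos_of_mem_periodicPts hd)), ?_⟩
    rw [Function.iterate_mod_minimalPeriod_eq, Equiv.Perm.iterate_eq_pow]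

theorem map_orbitList_perm [Finite D] (f : Equiv.Perm D) (d : D) :
    ((orbitList f d).map f).Perm (orbitList f d) := by
  refine (List.perm_ext_iff_of_nodup ((nodup_orbitList f d).map f.injective)
    (nodup_orbitList f d)).2 fun e => ?_
  rw [List.mem_map, mem_orbitList]
  constructor
  · rintro ⟨x, hx, rfl⟩
    exact Equiv.Perm.sameCycle_apply_right.2 ((mem_orbitList f d x).1 hx)
  · intro h
    refine ⟨f.symm e, (mem_orbitList f d _).2 ?_, f.apply_symm_apply e⟩
    exact Equiv.Perm.sameCycle_symm_apply_right.2 h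

end OrbitList

/-! ### Parities of incidences and crossings -/

section Parity

variable {V : Type*} {G : SimpleGraph V}

open Classical in
/-- The number of darts in the list whose edge contains `v`. -/
noncomputable def incidences (L : List G.Dart) (v : V) : ℕ := L.countP fun d => v ∈ d.edge

open Classical in
/-- The number of darts in the list that run along the edge `e`, in either direction. -/
noncomputable def traversals (L : List G.Dart) (e : Sym2 V) : ℕ := L.countP fun d => d.edge = e

/-- The list of darts meets every vertex an even number of times, like a closed walk. -/
def IsCyclic (L : List G.Dart) : Prop := ∀ v, Even (incidences L v)

open Classical in
theorem incidences_cons (d : G.Dart) (L : List G.Dart) (v : V) :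
    incidences (d :: L) v = incidences L v + if v ∈ d.edge then 1 else 0 := by
  simp only [incidences, List.countP_cons, decide_eq_true_eq]

open Classical in
theorem traversals_cons (d : G.Dart) (L : List G.Dart) (e : Sym2 V) :
    traversals (d :: L) e = traversals L e + if d.edge = e then 1 else 0 := by
  simp only [traversals, List.countP_cons, decide_eq_true_eq]

theorem incidences_append (L L' : List G.Dart) (v : V) :
    incidences (L ++ L') v = incidences L v + incidences L' v := List.countP_append

theorem IsCyclic.nil : IsCyclic ([] : List G.Dart) := fun _ => ⟨0, rfl⟩

theorem IsCyclic.append {L L' : List G.Dart} (h : IsCyclic L) (h' : IsCyclic L') :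
    IsCyclic (L ++ L') := fun v => by
  rw [incidences_append]
  exact (h v).add (h' v)

open Classical in
theorem incidences_eq_add (L : List G.Dart) (v : V) :
    incidences L v = (L.countP fun d => d.fst = v) + L.countP fun d => d.snd = v := by
  induction L with
  | nil => rfl
  | cons d L ih =>
    have hd := d.adj.ne
    rw [incidences_cons, ih]
    simp only [List.countP_cons, SimpleGraph.Dart.edge, Sym2.mem_iff, decide_eq_true_eq]
    by_cases h1 : d.fst = v
    · have h2 : d.snd ≠ v := fun h2 => hd (h1.trans h2.symm)
      simp [h1, h2, add_right_comm]
    · by_cases h2 : d.snd = v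
      · simp [h1, h2, add_assoc]
      · simp [h1, h2, Ne.symm h1, Ne.symm h2]

theorem isCyclic_darts {u : V} (p : G.Walk u u) : IsCyclic p.darts := by
  classical
  -- The induction needs open walks: tails and heads at `v` balance up to the two ends, which cancel
  -- for a closed walk.
  have key : ∀ {u w : V} (p : G.Walk u w) (v : V),
      (p.darts.countP fun d => d.fst = v) + (if w = v then 1 else 0) =
        (p.darts.countP fun d => d.snd = v) + if u = v then 1 else 0 := by
    intro u w p v
    induction p with
    | nil => rfl
    | cons h p ih =>
      simp only [SimpleGraph.Walk.darts_cons, List.countP_cons, decide_eq_true_eq]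
      omega
  intro v
  have := key p v
  rw [incidences_eq_add]
  exact ⟨p.darts.countP fun d => d.fst = v, by convert rfl using 2; omega⟩

/-- Face tracing permutes its orbit and sends a dart to one that starts at its head, so each vertex
occurs equally often as head and as tail. -/
theorem isCyclic_faceBoundary [Finite V] (R : RotationSystem G) (f : R.Face) :
    IsCyclic (R.faceBoundary f) := by
  classical
  intro v
  rw [incidences_eq_add]
  have h : (R.faceBoundary f).countP (fun d => d.snd = v) =
      (R.faceBoundary f).countP fun d => d.fst = v := by
    rw [RotationSystem.faceBoundary]
    conv_rhs => rw [← (map_orbitList_perm R.faceStep _).countP_eq, List.countP_map]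
    refine List.countP_congr fun d _ => ?_
    have : (R.faceStep d).fst = d.snd := (R.fst_next d.symm)
    simp [this]
  refine ⟨(R.faceBoundary f).countP fun d => d.fst = v, ?_⟩
  convert congrArg (_ + ·) h using 2

open Classical in
theorem traversals_of_nodup {L : List G.Dart} (hL : L.Nodup) (q : G.Dart) :
    traversals L q.edge = (if q ∈ L then 1 else 0) + if q.symm ∈ L then 1 else 0 := by
  have h : traversals L q.edge = L.count q + L.count q.symm := by
    clear hL
    induction L with
    | nil => rfl
    | cons d L ih =>
      have hq := q.symm_ne
      rw [traversals_cons, ih]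
      simp only [List.count_cons, beq_iff_eq, SimpleGraph.dart_edge_eq_iff]
      by_cases h1 : d = q
      · subst h1; simp [hq.symm, add_right_comm]
      · by_cases h2 : d = q.symm
        · subst h2; simp [hq, add_assoc]
        · simp [h1, h2]
  rw [h, hL.count, hL.count]

/-- Double counting: the rotation orbit lists all darts leaving the vertex, and without loops at
most one orientation of a given edge leaves it. This evaluates the crossings of a small loop around
a vertex. -/
theorem incidences_eq_sum_traversals [Finite V] (R : RotationSystem G) (L : List G.Dart)
    (d : G.Dart) :
    ((orbitList R.next d).map fun q => traversals L q.edge).sum = incidences L d.fst := by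
  classical
  have hmem : ∀ q : G.Dart, q ∈ orbitList R.next d ↔ q.fst = d.fst := by
    intro q
    rw [mem_orbitList]
    refine ⟨?_, fun h => R.sameCycle d q h.symm⟩
    intro h
    obtain ⟨m, -, rfl⟩ := h.exists_pow_eq'
    clear h
    induction m with
    | zero => rfl
    | succ m ih => rw [pow_succ', Equiv.Perm.mul_apply, R.fst_next, ih]
  induction L with
  | nil => simp [traversals, incidences]
  | cons x L ih =>
    have h1 : ∀ q : G.Dart, traversals (x :: L) q.edge =
        traversals L q.edge + if q.edge = x.edge then 1 else 0 := by
      intro q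
      simp only [traversals_cons, eq_comm]
    have h2 := incidences_cons x L d.fst
    have h3 : ((orbitList R.next d).map fun q => if q.edge = x.edge then 1 else 0).sum =
        traversals (orbitList R.next d) x.edge := by
      rw [traversals]
      generalize orbitList R.next d = O
      induction O with
      | nil => rfl
      | cons y O ih => simp [List.countP_cons, ih, add_comm]
    simp only [h1, h2, List.sum_map_add, ih, h3, traversals_of_nodup (nodup_orbitList _ _), hmem]
    have hx := x.adj.ne
    have h4 : x.symm.fst = x.snd := rfl
    rw [h4]
    simp only [SimpleGraph.Dart.edge, Sym2.mem_iff, eq_comm (a := d.fst)]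
    by_cases h5 : x.fst = d.fst
    · have h6 : x.snd ≠ d.fst := fun h => hx (h5.trans h.symm)
      simp [h5, h6]
    · simp [h5]

theorem site_mem (q : G.Dart × Bool) : site q ∈ q.1.edge := by
  unfold site
  split
  · exact Sym2.mem_mk_left _ _
  · exact Sym2.mem_mk_right _ _

/-- The number of times that the edges crossed by `p` are traversed by `L`. -/
noncomputable def crossings (L p : List G.Dart) : ℕ := (p.map fun q => traversals L q.edge).sum

theorem intersections_eq_crossings {u v : V} (l : G.Walk u v) (s : DualString G) :
    intersections l s = crossings l.darts s.path := by
  classical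
  rw [intersections, crossings, DualString.path, List.map_map]
  congr 1
  refine List.map_congr_left fun q _ => ?_
  simp only [SimpleGraph.Walk.edges, List.count_eq_countP, List.countP_map, traversals,
    Function.comp]
  refine List.countP_congr fun d _ => ?_
  simp

theorem crossings_append (L p q : List G.Dart) :
    crossings L (p ++ q) = crossings L p + crossings L q := by
  simp [crossings]

theorem crossings_map_symm_reverse (L p : List G.Dart) :
    crossings L (p.map SimpleGraph.Dart.symm).reverse = crossings L p := by
  simp [crossings, Function.comp_def]

/-- Rotation permutes the crossings, backtracking counts one edge twice, and a push changes the
count by the star of a vertex, which a cyclic list meets evenly. -/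
theorem even_crossings_iff_of_dualMove [Finite V] (R : RotationSystem G) {L : List G.Dart}
    (hL : IsCyclic L) {p q : List G.Dart} (h : R.DualMove p q) :
    Even (crossings L p) ↔ Even (crossings L q) := by
  cases h with
  | rotate l₁ l₂ => rw [crossings_append, crossings_append, add_comm]
  | backtrack l₁ l₂ d =>
    have : crossings L [d, d.symm] = 2 * traversals L d.edge := by
      simp [crossings, two_mul]
    simp only [crossings_append, this]
    grind
  | push l₁ l₂ a b d h =>
    have h1 : crossings L a + crossings L b = incidences L d.fst := by
      rw [← incidences_eq_sum_traversals R, ← crossings_map_symm_reverse L b, ← crossings_append]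
      exact (h.perm.map _).sum_eq
    have h2 := hL d.fst
    rw [← h1] at h2
    simp only [crossings_append]
    grind

theorem even_crossings_iff_of_deformable [Finite V] (R : RotationSystem G) {holes : Set R.Face}
    {L : List G.Dart} (hL : IsCyclic L) {p q : List G.Dart} (h : R.DualDeformable holes p q) :
    Even (crossings L p) ↔ Even (crossings L q) := by
  induction h with
  | rel p q h => exact even_crossings_iff_of_dualMove R hL h.2.2
  | refl p => rfl
  | symm p q _ ih => exact ih.symm
  | trans p q r _ _ ih ih' => exact ih.trans ih'

theorem isDualPath_iff_of_deformable (R : RotationSystem G) {holes : Set R.Face}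
    {p q : List G.Dart} (h : R.DualDeformable holes p q) :
    R.IsDualPath holes p ↔ R.IsDualPath holes q := by
  induction h with
  | rel p q h => exact iff_of_true h.1 h.2.1
  | refl p => rfl
  | symm p q _ ih => exact ih.symm
  | trans p q r _ _ ih ih' => exact ih.trans ih'

/-- A crossing contributes once for each of its two sides that equals `f`. Consecutive crossings
share a face, so modulo two the sum telescopes to the first and last faces: these coincide for a
closed path and are holes, hence not `f`, otherwise. -/
theorem even_crossings_faceBoundary [Finite V] (R : RotationSystem G) {holes : Set R.Face}
    {p : List G.Dart} (hp : R.IsDualPath holes p) {f : R.Face} (hf : f ∉ holes) :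
    Even (crossings (R.faceBoundary f) p) := by
  classical
  have hmem : ∀ q : G.Dart, q ∈ R.faceBoundary f ↔ R.face q = f := by
    intro q
    rw [RotationSystem.faceBoundary, mem_orbitList]
    have h1 : R.face q = f ↔ R.face (Quotient.out f) = R.face q := by
      rw [show R.face (Quotient.out f) = f from Quotient.out_eq f, eq_comm]
    exact (h1.trans (Quotient.eq (r := Equiv.Perm.SameCycle.setoid R.faceStep))).symm
  have htr : ∀ q : G.Dart, traversals (R.faceBoundary f) q.edge =
      (if R.face q = f then 1 else 0) + if R.face q.symm = f then 1 else 0 := by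
    intro q
    have h := traversals_of_nodup (L := R.faceBoundary f) (nodup_orbitList _ _) q
    simp only [hmem] at h
    convert h
  -- along a chain of crossings only the first and the last face can be met an odd number of times
  have key : ∀ (e : G.Dart) (l : List G.Dart), (e :: l).IsChain (R.DualStep holes) →
      Even (crossings (R.faceBoundary f) (e :: l) + (if R.face e = f then 1 else 0) +
        if R.face ((e :: l).getLast (List.cons_ne_nil e l)).symm = f then 1 else 0) := by
    intro e l
    induction l generalizing e with
    | nil =>
      intro _
      simp only [crossings, List.map_cons, List.map_nil, List.sum_cons, List.sum_nil, htr,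
        List.getLast_singleton]
      grind
    | cons e' l ih =>
      intro h
      rw [List.isChain_cons_cons] at h
      have h1 := ih e' h.2
      have h2 : crossings (R.faceBoundary f) (e :: e' :: l) =
          (if R.face e = f then 1 else 0) + (if R.face e' = f then 1 else 0) +
            crossings (R.faceBoundary f) (e' :: l) := by
        rw [crossings, List.map_cons, List.sum_cons, htr, h.1.1]
        rfl
      rw [h2, List.getLast_cons (List.cons_ne_nil e' l)]
      grind
  obtain ⟨hne, hchain, hends⟩ := hp
  obtain ⟨e, l, rfl⟩ := List.exists_cons_of_ne_nil hne
  have h1 := key e l hchain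
  set z := (e :: l).getLast (List.cons_ne_nil e l) with hz
  have hlast : z ∈ (e :: l).getLast? := by
    rw [List.getLast?_eq_getLast_of_ne_nil (List.cons_ne_nil e l)]; rfl
  rcases hends with h | ⟨h, h'⟩
  · have h2 := (h z hlast e rfl).1
    rw [h2] at h1
    grind
  · have h2 := h e rfl
    have h3 := h' z hlast
    have h4 : R.face e ≠ f := fun h => hf (h ▸ h2)
    have h5 : R.face z.symm ≠ f := fun h => hf (h ▸ h3)
    rw [if_neg h4, if_neg h5] at h1
    exact h1

open Classical in
theorem mem_edgeSet_of_odd_traversals {L : List G.Dart} {e : Sym2 V} (h : Odd (traversals L e)) :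
    e ∈ G.edgeSet := by
  obtain ⟨d, -, hd⟩ := List.countP_pos_iff.1 h.pos
  exact of_decide_eq_true hd ▸ d.edge_mem

/-- Turns cyclicity of a list into evenness of the degrees in the subgraph of oddly traversed edges.
-/
theorem incidences_eq_sum_edges [Fintype V] (L : List G.Dart) (v : V) [DecidableEq (Sym2 V)]
    [Fintype (Sym2 V)] [DecidablePred fun e : Sym2 V => v ∈ e] :
    ∑ e : Sym2 V with v ∈ e, traversals L e = incidences L v := by
  classical
  induction L with
  | nil => simp [traversals, incidences]
  | cons d L ih =>
    simp only [traversals, incidences, List.countP_cons, Finset.sum_add_distrib] at ih ⊢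
    rw [ih]
    simp [Finset.sum_ite_eq]

end Parity

/-! ### Commutation up to sign -/

section SignCommute

variable {A : Type*} [Ring A] [Algebra ℂ A]

/-- `a` and `b` commute up to the sign `(-1) ^ n`. -/
def SignCommute (n : ℕ) (a b : A) : Prop := a * b = (-1 : ℂ) ^ n • (b * a)

theorem SignCommute.symm {n : ℕ} {a b : A} (h : SignCommute n a b) : SignCommute n b a := by
  unfold SignCommute at *
  rw [h, smul_smul, ← mul_pow, neg_one_mul, neg_neg, one_pow, one_smul]

theorem SignCommute.of_parity {n m : ℕ} {a b : A} (h : SignCommute n a b) (hnm : Even n ↔ Even m) :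
    SignCommute m a b := by
  unfold SignCommute at *
  rw [h]
  by_cases hm : Even m
  · rw [hm.neg_one_pow, (hnm.2 hm).neg_one_pow]
  · rw [(Nat.not_even_iff_odd.1 hm).neg_one_pow,
      (Nat.not_even_iff_odd.1 fun hn => hm (hnm.1 hn)).neg_one_pow]

theorem SignCommute.commute {n : ℕ} {a b : A} (h : SignCommute n a b) (hn : Even n) :
    Commute a b := by
  unfold SignCommute at h
  rwa [hn.neg_one_pow, one_smul] at h

theorem SignCommute.anticommute {n : ℕ} {a b : A} (h : SignCommute n a b) (hn : Odd n) :
    a * b = -(b * a) := by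
  unfold SignCommute at h
  rwa [hn.neg_one_pow, neg_one_smul] at h

theorem signCommute_zero {a b : A} : SignCommute 0 a b ↔ Commute a b := by
  rw [SignCommute, pow_zero, one_smul]; rfl

theorem signCommute_one {a b : A} : SignCommute 1 a b ↔ a * b = -(b * a) := by
  rw [SignCommute, pow_one, neg_one_smul]

theorem SignCommute.mul_right {m n : ℕ} {a b c : A} (h : SignCommute m a b)
    (h' : SignCommute n a c) : SignCommute (m + n) a (b * c) := by
  unfold SignCommute at *
  rw [← mul_assoc, h, smul_mul_assoc, mul_assoc, h', mul_smul_comm, smul_smul, pow_add, mul_assoc]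

theorem SignCommute.mul_left {m n : ℕ} {a b c : A} (h : SignCommute m a c)
    (h' : SignCommute n b c) : SignCommute (m + n) (a * b) c :=
  (h.symm.mul_right h'.symm).symm

theorem SignCommute.smul_left {n : ℕ} {a b : A} (z : ℂ) (h : SignCommute n a b) :
    SignCommute n (z • a) b := by
  unfold SignCommute at *
  rw [smul_mul_assoc, h, mul_smul_comm, smul_comm]

theorem SignCommute.list_prod_left {ι : Type*} {n : ι → ℕ} {f : ι → A} {b : A} {L : List ι}
    (h : ∀ i ∈ L, SignCommute (n i) (f i) b) :
    SignCommute (L.map n).sum (L.map f).prod b := by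
  induction L with
  | nil => exact signCommute_zero.2 (Commute.one_left b)
  | cons i L ih =>
    simp only [List.map_cons, List.sum_cons, List.prod_cons]
    exact (h i List.mem_cons_self).mul_left (ih fun j hj => h j (List.mem_cons_of_mem i hj))

end SignCommute

theorem smul_mem_unitaryGroup {n : Type*} [Fintype n] [DecidableEq n] {z : ℂ}
    (hz : ‖z‖ = 1) {A : Matrix n n ℂ} (hA : A ∈ Matrix.unitaryGroup n ℂ) :
    z • A ∈ Matrix.unitaryGroup n ℂ := by
  rw [Matrix.mem_unitaryGroup_iff] at *
  rw [star_smul, smul_mul_smul_comm, hA, Complex.star_def, Complex.mul_conj, Complex.normSq_eq_norm_sq,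
    hz]
  simp

/-! ### Signs between strings, gamma matrices and chiral elements -/

namespace Model

variable {V : Type*} [Fintype V] [DecidableEq V] {G : SimpleGraph V} [DecidableRel G.Adj]
  (M : Model G)

omit [DecidableEq V] in
theorem label_color_injective {v : V} {e f : Sym2 V} (he : e ∈ G.edgeSet) (hf : f ∈ G.edgeSet)
    (hve : v ∈ e) (hvf : v ∈ f) (h : M.label v (M.color e) = M.label v (M.color f)) : e = f := by
  obtain ⟨a, rfl⟩ := Sym2.mem_iff_exists.1 hve
  obtain ⟨b, rfl⟩ := Sym2.mem_iff_exists.1 hvf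
  rw [SimpleGraph.mem_edgeSet] at he hf
  rw [M.color_rule v a b he hf (M.label_injective v a b he hf h)]

open Classical in
theorem signCommute_Gam {u v : V} {e f : Sym2 V} (he : e ∈ G.edgeSet) (hf : f ∈ G.edgeSet)
    (hue : u ∈ e) (hvf : v ∈ f) :
    SignCommute (if u = v ∧ e ≠ f then 1 else 0) (M.Gam u (M.color e)) (M.Gam v (M.color f)) := by
  by_cases huv : u = v
  · subst huv
    by_cases hef : e = f
    · subst hef
      simp only [ne_eq, not_true, and_false, if_false]
      exact signCommute_zero.2 (Commute.refl _)
    · simp only [ne_eq, hef, not_false_iff, and_true, if_true]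
      exact signCommute_one.2 (M.onSite_gamma_anticomm u
        fun h => hef (M.label_color_injective he hf hue hvf h))
  · simp only [huv, false_and, if_false]
    exact signCommute_zero.2 (onSite_commute_of_ne huv _ _)

open Classical in
-- If `v` lies on `d`, one factor of the edge term sits at `v` and anticommutes with the given gamma
-- matrix, unless it is that same matrix; the second indicator corrects for this case.
theorem signCommute_edgeTerm_Gam (d : G.Dart) {v : V} {e : Sym2 V} (he : e ∈ G.edgeSet)
    (hve : v ∈ e) : SignCommute ((if v ∈ d.edge then 1 else 0) + if d.edge = e then 1 else 0)
      (M.edgeTerm d) (M.Gam v (M.color e)) := by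
  have h1 : d.fst ∈ d.edge := Sym2.mem_mk_left _ _
  have h2 : d.snd ∈ d.edge := Sym2.mem_mk_right _ _
  refine ((M.signCommute_Gam d.edge_mem he h1 hve).mul_left
    (M.signCommute_Gam d.edge_mem he h2 hve)).of_parity ?_
  have hd := d.adj.ne
  by_cases hde : d.edge = e
  · subst hde; simp [hve]
  · have h3 : v ∈ d.edge ↔ d.fst = v ∨ d.snd = v := by
      simp only [SimpleGraph.Dart.edge, Sym2.mem_iff, eq_comm]
    simp only [h3]
    grind

theorem signCommute_fluxString_Gam (L : List G.Dart) {v : V} {e : Sym2 V} (he : e ∈ G.edgeSet)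
    (hve : v ∈ e) :
    SignCommute (incidences L v + traversals L e) (M.fluxString L) (M.Gam v (M.color e)) := by
  induction L with
  | nil => exact signCommute_zero.2 (Commute.one_left _)
  | cons d L ih =>
    refine ((M.signCommute_edgeTerm_Gam d he hve).mul_left ih).of_parity ?_
    rw [incidences_cons, traversals_cons]
    grind

theorem signCommute_fluxString_Gam_of_isCyclic {L : List G.Dart} (hL : IsCyclic L) {v : V}
    {e : Sym2 V} (he : e ∈ G.edgeSet) (hve : v ∈ e) :
    SignCommute (traversals L e) (M.fluxString L) (M.Gam v (M.color e)) :=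
  (M.signCommute_fluxString_Gam L he hve).of_parity (by have := hL v; grind)

/-- The gamma matrices at the two ends of an edge give the same sign, so the signs cancel. -/
theorem commute_fluxString_edgeTerm {L : List G.Dart} (hL : IsCyclic L) (d : G.Dart) :
    Commute (M.fluxString L) (M.edgeTerm d) :=
  ((M.signCommute_fluxString_Gam_of_isCyclic hL d.edge_mem (Sym2.mem_mk_left _ _)).mul_right
    (M.signCommute_fluxString_Gam_of_isCyclic hL d.edge_mem (Sym2.mem_mk_right _ _))).commute
      ⟨_, rfl⟩

theorem commute_fluxString {L : List G.Dart} (hL : IsCyclic L) (L' : List G.Dart) :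
    Commute (M.fluxString L) (M.fluxString L') := by
  refine Commute.list_prod_right _ _ fun K hK => ?_
  obtain ⟨d, -, rfl⟩ := List.mem_map.1 hK
  exact M.commute_fluxString_edgeTerm hL d

theorem commute_fluxString_hamiltonian {L : List G.Dart} (hL : IsCyclic L) (J : Sym2 V → ℝ) :
    Commute (M.fluxString L) (M.hamiltonian J) :=
  ((Commute.sum_right _ _ _ fun d _ =>
    (M.commute_fluxString_edgeTerm hL d).smul_right _).smul_right _).neg_right

theorem signCommute_fluxString_dualOp {L : List G.Dart} (hL : IsCyclic L) (s : DualString G) :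
    SignCommute (crossings L s.path) (M.fluxString L) (M.dualOp s) := by
  rw [crossings, DualString.path, List.map_map]
  exact (SignCommute.list_prod_left fun q _ => (M.signCommute_fluxString_Gam_of_isCyclic hL
    q.1.edge_mem (site_mem q)).symm).symm

open Classical in
theorem signCommute_Gam_dualOp {v : V} {e : Sym2 V} (he : e ∈ G.edgeSet) (hve : v ∈ e)
    (t : DualString G) : SignCommute (t.countP fun r => v = site r ∧ e ≠ r.1.edge)
      (M.Gam v (M.color e)) (M.dualOp t) := by
  induction t with
  | nil => exact signCommute_zero.2 (Commute.one_right _)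
  | cons r t ih =>
    rw [List.countP_cons, add_comm]
    simp only [decide_eq_true_eq]
    exact (M.signCommute_Gam he r.1.edge_mem hve (site_mem r)).mul_right ih

theorem signCommute_dualOp (s t : DualString G) :
    SignCommute (clashes s t) (M.dualOp s) (M.dualOp t) :=
  SignCommute.list_prod_left fun q _ => by
    convert M.signCommute_Gam_dualOp q.1.edge_mem (site_mem q) t

open Classical in
theorem signCommute_chiral_onSite_gamma (u v : V) (μ : Fin (2 * halfRank G v)) :
    SignCommute (if v = u then 1 else 0) (M.chiral u) (onSite v (M.gamma v μ)) := by
  refine SignCommute.smul_left _ ?_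
  rw [List.ofFn_eq_map]
  by_cases h : v = u
  · subst h
    refine (SignCommute.list_prod_left (n := fun ν => if ν = μ then 0 else 1) ?_).of_parity ?_
    · intro ν _
      by_cases hν : ν = μ
      · subst hν
        rw [if_pos rfl]
        exact signCommute_zero.2 (Commute.refl _)
      · rw [if_neg hν]
        exact signCommute_one.2 (M.onSite_gamma_anticomm v hν)
    -- All of the `2k` gamma matrices except the `μ`-th anticommute with it, and `2k - 1` is odd.
    · have h1 : ((List.finRange (2 * halfRank G v)).map fun ν => if ν = μ then 0 else 1).sum + 1 =
          2 * halfRank G v := by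
        rw [← List.ofFn_eq_map, List.sum_ofFn]
        have h2 : ∑ ν, ((if ν = μ then 0 else 1) + if ν = μ then 1 else 0) = 2 * halfRank G v := by
          rw [Finset.sum_congr rfl (g := fun _ => 1) fun ν _ => by split <;> rfl]
          simp
        rw [Finset.sum_add_distrib] at h2
        simpa using h2
      rw [if_pos rfl]
      grind
  · rw [if_neg h]
    refine signCommute_zero.2 (Commute.list_prod_left _ _ fun K hK => ?_)
    obtain ⟨ν, -, rfl⟩ := List.mem_map.1 hK
    exact onSite_commute_of_ne (Ne.symm h) _ _

theorem signCommute_fluxString_chiral (L : List G.Dart) (u : V) :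
    SignCommute (incidences L u) (M.fluxString L) (M.chiral u) := by
  classical
  induction L with
  | nil => exact signCommute_zero.2 (Commute.one_left _)
  | cons d L ih =>
    refine (((M.signCommute_chiral_onSite_gamma u d.fst _).mul_right
      (M.signCommute_chiral_onSite_gamma u d.snd _)).symm.mul_left ih).of_parity ?_
    rw [incidences_cons]
    have hd := d.adj.ne
    have h3 : u ∈ d.edge ↔ d.fst = u ∨ d.snd = u := by
      simp only [SimpleGraph.Dart.edge, Sym2.mem_iff, eq_comm]
    simp only [h3]
    by_cases h : d.fst = u
    · have : d.snd ≠ u := fun h' => hd (h.trans h'.symm)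
      simp [h, this, add_comm]
    · simp [h, add_comm]

open Classical in
theorem signCommute_chiral_dualOp (v : V) (s : DualString G) :
    SignCommute (s.countP fun q => site q = v) (M.chiral v) (M.dualOp s) := by
  induction s with
  | nil => exact signCommute_zero.2 (Commute.one_right _)
  | cons r t ih =>
    rw [List.countP_cons, add_comm]
    simp only [decide_eq_true_eq]
    exact (M.signCommute_chiral_onSite_gamma v (site r) _).mul_right ih

theorem Gam_mem_unitary (v : V) (α : Fin (G.maxDegree + 1)) :
    M.Gam v α ∈ Matrix.unitaryGroup (Conf G) ℂ := M.onSite_gamma_mem_unitary v _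

theorem edgeTerm_mem_unitary (d : G.Dart) : M.edgeTerm d ∈ Matrix.unitaryGroup (Conf G) ℂ :=
  mul_mem (M.Gam_mem_unitary _ _) (M.Gam_mem_unitary _ _)

theorem fluxString_mem_unitary (L : List G.Dart) :
    M.fluxString L ∈ Matrix.unitaryGroup (Conf G) ℂ := by
  refine list_prod_mem fun K hK => ?_
  obtain ⟨d, -, rfl⟩ := List.mem_map.1 hK
  exact M.edgeTerm_mem_unitary d

theorem dualOp_mem_unitary (s : DualString G) :
    M.dualOp s ∈ Matrix.unitaryGroup (Conf G) ℂ := by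
  refine list_prod_mem fun K hK => ?_
  obtain ⟨d, -, rfl⟩ := List.mem_map.1 hK
  exact M.Gam_mem_unitary _ _

theorem chiral_mem_unitary (v : V) : M.chiral v ∈ Matrix.unitaryGroup (Conf G) ℂ := by
  refine smul_mem_unitaryGroup (by simp) (list_prod_mem fun K hK => ?_)
  obtain ⟨μ, rfl⟩ := (List.mem_ofFn' _ _).1 hK
  exact M.onSite_gamma_mem_unitary _ _

theorem commute_fluxString_jump {L : List G.Dart} (hL : IsCyclic L) (γ : V → ℝ) (j : V) :
    Commute (M.fluxString L) (M.jump γ j) :=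
  ((M.signCommute_fluxString_chiral L j).commute (hL j)).smul_right _

theorem edgeTerm_mul_self (d : G.Dart) : M.edgeTerm d * M.edgeTerm d = 1 := by
  have hc : Commute (M.Gam d.fst (M.color d.edge)) (M.Gam d.snd (M.color d.edge)) :=
    onSite_commute_of_ne d.adj.ne _ _
  unfold edgeTerm
  rw [hc.symm.mul_mul_mul_comm, Gam, Gam, M.onSite_gamma_mul_self, M.onSite_gamma_mul_self, one_mul]

/-- An edge term squares to one and moves past the rest of the string at the cost of a sign. Hence
flux eigenvalues can only be fourth roots of unity. -/
theorem exists_fluxString_mul_self (L : List G.Dart) :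
    ∃ n : ℕ, M.fluxString L * M.fluxString L = (-1 : ℂ) ^ n • 1 := by
  induction L with
  | nil => exact ⟨0, by simp [fluxString]⟩
  | cons d L ih =>
    obtain ⟨n, hn⟩ := ih
    have h := (M.signCommute_fluxString_Gam L d.edge_mem (Sym2.mem_mk_left _ _)).mul_right
      (M.signCommute_fluxString_Gam L d.edge_mem (Sym2.mem_mk_right _ _))
    refine ⟨incidences L d.fst + traversals L d.edge + (incidences L d.snd + traversals L d.edge) + n,
      ?_⟩
    change M.edgeTerm d * M.fluxString L * (M.edgeTerm d * M.fluxString L) = _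
    have h' : M.fluxString L * M.edgeTerm d = _ := h
    rw [mul_assoc, ← mul_assoc (M.fluxString L), h', smul_mul_assoc, mul_smul_comm,
      mul_assoc _ _ (M.fluxString L), hn, ← mul_assoc]
    rw [mul_smul_comm, mul_one, show M.Gam d.fst _ * M.Gam d.snd _ = M.edgeTerm d from rfl,
      M.edgeTerm_mul_self, smul_smul, ← pow_add]

end Model

/-- An operator that anticommutes with a unitary is traceless. -/
theorem trace_eq_zero_of_anticommute {n : Type*} [Fintype n] [DecidableEq n] {U A : Matrix n n ℂ}
    (hU : U ∈ Matrix.unitaryGroup n ℂ) (h : U * A = -(A * U)) : A.trace = 0 := by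
  have h1 : A.trace = -A.trace := by
    calc A.trace = (star U * (U * A)).trace := by
          rw [← mul_assoc, Matrix.mem_unitaryGroup_iff'.1 hU, one_mul]
      _ = -(A * U * star U).trace := by
          rw [h, mul_neg, Matrix.trace_neg, Matrix.trace_mul_comm]
      _ = -A.trace := by rw [mul_assoc, Matrix.mem_unitaryGroup_iff.1 hU, mul_one]
  exact self_eq_neg.1 h1

/-- If the operator `W_L Z_s` along a cyclic list `L` and a dual string `s` has nonzero trace, then
the gamma matrices occurring an odd number of times in `Z_s` are those of the edges traversed an odd
number of times by `L`. -/
theorem Model.odd_multiplicity_iff_of_trace_ne_zero {V : Type*} [Fintype V] [DecidableEq V]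
    {G : SimpleGraph V} [DecidableRel G.Adj] (M : Model G) {L : List G.Dart} (hL : IsCyclic L)
    (s : DualString G) (h : (M.fluxString L * M.dualOp s).trace ≠ 0) {v : V} {e : Sym2 V}
    (he : e ∈ G.edgeSet) (hve : v ∈ e) : Odd (s.multiplicity v e) ↔ Odd (traversals L e) := by
  classical
  -- The chiral element at `v` commutes with the cyclic flux, so a nonzero trace forces an even
  -- number of gamma matrices of `s` at `v`.
  have h1 : Even (s.countP fun q => site q = v) := by
    by_contra ho
    have hs := ((M.signCommute_fluxString_chiral L v).symm.mul_right
      (M.signCommute_chiral_dualOp v s)).anticommute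
        ((hL v).add_odd (by convert Nat.not_even_iff_odd.1 ho))
    exact h (trace_eq_zero_of_anticommute (M.chiral_mem_unitary v) hs)
  -- The same test with the gamma matrix of `e` at `v`, which sees all gamma matrices of `s` at `v`
  -- except copies of itself.
  have h2 : Even (traversals L e + s.countP fun r => v = site r ∧ e ≠ r.1.edge) := by
    by_contra ho
    have hs := ((M.signCommute_fluxString_Gam_of_isCyclic hL he hve).symm.mul_right
      (M.signCommute_Gam_dualOp he hve s)).anticommute (by convert Nat.not_even_iff_odd.1 ho)
    exact h (trace_eq_zero_of_anticommute (M.Gam_mem_unitary v _) hs)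
  have h3 : (s.countP fun q => site q = v) =
      (s.countP fun r => v = site r ∧ e ≠ r.1.edge) + s.multiplicity v e := by
    clear h h1 h2
    induction s with
    | nil => rfl
    | cons q s ih =>
      have h4 : DualString.multiplicity (q :: s) v e = DualString.multiplicity s v e +
          if site q = v ∧ q.1.edge = e then 1 else 0 := by
        simp only [DualString.multiplicity, List.countP_cons, decide_eq_true_eq]
      simp only [List.countP_cons, decide_eq_true_eq]
      rw [ih, h4]
      grind
  grind

/-- If the operator `W_L Z_s Z_t` along a cyclic list `L` and dual strings `s`, `t` has nonzero
trace, then `s` and `t` differ by a flux. -/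
theorem Model.differByFlux_of_trace_ne_zero {V : Type*} [Fintype V] [DecidableEq V]
    {G : SimpleGraph V} [DecidableRel G.Adj] (M : Model G) {L : List G.Dart} (hL : IsCyclic L)
    (s t : DualString G) (h : (M.fluxString L * (M.dualOp s * M.dualOp t)).trace ≠ 0) :
    DifferByFlux s t := by
  classical
  have hst : M.dualOp s * M.dualOp t = M.dualOp (s ++ t) := by
    simp only [dualOp, List.map_append, List.prod_append]
  rw [hst] at h
  -- The even subgraph consists of the edges that `L` traverses an odd number of times.
  refine ⟨Finset.univ.filter fun e => Odd (traversals L e), ?_, ?_, ?_⟩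
  · intro e he
    exact mem_edgeSet_of_odd_traversals (Finset.mem_filter.1 he).2
  · intro v
    have h1 := hL v
    rw [← incidences_eq_sum_edges, Finset.even_sum_iff_even_card_odd, Finset.filter_filter] at h1
    rw [Finset.filter_filter]
    convert h1 using 3
    exact and_comm
  · intro v e he hve
    have h1 := M.odd_multiplicity_iff_of_trace_ne_zero hL (s ++ t) h he hve
    have h2 : (s ++ t).multiplicity v e = s.multiplicity v e + t.multiplicity v e :=
      List.countP_append
    rw [← h2]
    simpa using h1

/-! ### Flux projectors -/

namespace Model

variable {V : Type*} [Fintype V] [DecidableEq V] {G : SimpleGraph V} [DecidableRel G.Adj]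
  (M : Model G)

/-- The factor `(1 + w^* W)/2` of a sector projector, with `W` the flux along a list of darts. -/
noncomputable def fluxFactor (x : List G.Dart × ℂ) : Op G :=
  (1 / 2 : ℂ) • (1 + star x.2 • M.fluxString x.1)

theorem fluxString_eigenvalue {L : List G.Dart} {w : ℂ} {ψ : Conf G → ℂ} (hψ : ψ ≠ 0)
    (h : M.fluxString L *ᵥ ψ = w • ψ) :
    star w * w = 1 ∧ M.fluxString L * M.fluxString L = (w * w) • 1 := by
  obtain ⟨n, hn⟩ := M.exists_fluxString_mul_self L
  have h1 : (w * w) • ψ = (-1 : ℂ) ^ n • ψ := by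
    rw [mul_smul, ← h, ← Matrix.mulVec_smul, ← h, Matrix.mulVec_mulVec, hn, Matrix.smul_mulVec,
      Matrix.one_mulVec]
  have h2 : w * w = (-1 : ℂ) ^ n := smul_left_injective ℂ hψ h1
  refine ⟨?_, by rw [hn, h2]⟩
  have h3 : ‖w‖ * ‖w‖ = 1 := by
    rw [← norm_mul, h2, norm_pow, norm_neg, norm_one, one_pow]
  rw [mul_comm, Complex.star_def, Complex.mul_conj, Complex.normSq_eq_norm_sq, sq, h3]
  simp

theorem isStarProjection_fluxFactor {L : List G.Dart} {w : ℂ} (hw : star w * w = 1)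
    (h : M.fluxString L * M.fluxString L = (w * w) • 1) :
    IsStarProjection (M.fluxFactor (L, w)) := by
  set B : Op G := star w • M.fluxString L with hB
  have hBB : B * B = 1 := by
    rw [hB, smul_mul_smul_comm, h, smul_smul, mul_mul_mul_comm, hw, one_mul, one_smul]
  have hBs : star B * B = 1 := by
    rw [hB, star_smul, star_star, smul_mul_smul_comm,
      Matrix.mem_unitaryGroup_iff'.1 (M.fluxString_mem_unitary L), mul_comm, hw, one_smul]
  -- A unitary involution is self-adjoint.
  have hsa : star B = B := by
    rw [← mul_one (star B), ← hBB, ← mul_assoc, hBs, one_mul]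
  refine ⟨?_, ?_⟩
  · change (1 / 2 : ℂ) • (1 + B) * (1 / 2 : ℂ) • (1 + B) = (1 / 2 : ℂ) • (1 + B)
    rw [smul_mul_smul_comm, mul_add, mul_one, add_mul, one_mul, hBB]
    module
  · change star ((1 / 2 : ℂ) • (1 + B)) = (1 / 2 : ℂ) • (1 + B)
    rw [star_smul, star_add, star_one, hsa]
    simp

theorem commute_fluxFactor {A : Op G} {L : List G.Dart} (h : Commute A (M.fluxString L)) (w : ℂ) :
    Commute A (M.fluxFactor (L, w)) :=
  ((Commute.one_right A).add_right (h.smul_right _)).smul_right _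

theorem commute_prod_fluxFactor {A : Op G} {F : List (List G.Dart × ℂ)}
    (h : ∀ x ∈ F, Commute A (M.fluxString x.1)) : Commute A (F.map M.fluxFactor).prod := by
  refine Commute.list_prod_right _ _ fun K hK => ?_
  obtain ⟨x, hx, rfl⟩ := List.mem_map.1 hK
  exact M.commute_fluxFactor (h x hx) _

theorem isStarProjection_prod_fluxFactor {F : List (List G.Dart × ℂ)}
    (hF : ∀ x ∈ F, IsCyclic x.1) {ψ : Conf G → ℂ} (hψ : ψ ≠ 0)
    (h : ∀ x ∈ F, M.fluxString x.1 *ᵥ ψ = x.2 • ψ) :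
    IsStarProjection (F.map M.fluxFactor).prod := by
  induction F with
  | nil => exact IsStarProjection.one _
  | cons x F ih =>
    obtain ⟨h1, h2⟩ := M.fluxString_eigenvalue hψ (h x List.mem_cons_self)
    refine (M.isStarProjection_fluxFactor h1 h2).mul
      (ih (fun y hy => hF y (List.mem_cons_of_mem _ hy))
        fun y hy => h y (List.mem_cons_of_mem _ hy)) ?_
    refine M.commute_prod_fluxFactor fun y _ => ?_
    exact (M.commute_fluxFactor (M.commute_fluxString (hF x List.mem_cons_self) y.1).symm _).symm

theorem prod_fluxFactor_mulVec {F : List (List G.Dart × ℂ)} {ψ : Conf G → ℂ} (hψ : ψ ≠ 0)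
    (h : ∀ x ∈ F, M.fluxString x.1 *ᵥ ψ = x.2 • ψ) :
    (F.map M.fluxFactor).prod *ᵥ ψ = ψ := by
  induction F with
  | nil => simp
  | cons x F ih =>
    have hx := h x List.mem_cons_self
    rw [List.map_cons, List.prod_cons, ← Matrix.mulVec_mulVec,
      ih fun y hy => h y (List.mem_cons_of_mem _ hy), fluxFactor, Matrix.smul_mulVec,
      Matrix.add_mulVec, Matrix.one_mulVec, Matrix.smul_mulVec, hx, smul_smul,
      (M.fluxString_eigenvalue hψ hx).1]
    module

/-- Since W² = w² and |w| = 1, multiplication by W swaps the two terms of 1 + w^*W up to the factor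
w. -/
theorem fluxString_mul_fluxFactor {L : List G.Dart} {w : ℂ} (hw : star w * w = 1)
    (h : M.fluxString L * M.fluxString L = (w * w) • 1) :
    M.fluxString L * M.fluxFactor (L, w) = w • M.fluxFactor (L, w) := by
  have h1 : w * (1 / 2) * star w = 1 / 2 := by linear_combination (1 / 2) * hw
  have h2 : 1 / 2 * star w * (w * w) = w * (1 / 2) := by linear_combination (w / 2) * hw
  change M.fluxString L * ((1 / 2 : ℂ) • (1 + star w • M.fluxString L)) =
    w • ((1 / 2 : ℂ) • (1 + star w • M.fluxString L))
  rw [mul_smul_comm, mul_add, mul_one, mul_smul_comm, h, smul_add, smul_smul, smul_smul,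
    smul_smul, smul_add, smul_smul, h2, h1,
    add_comm]

theorem fluxString_mul_prod_fluxFactor {F : List (List G.Dart × ℂ)}
    (hF : ∀ x ∈ F, IsCyclic x.1) {ψ : Conf G → ℂ} (hψ : ψ ≠ 0)
    (h : ∀ x ∈ F, M.fluxString x.1 *ᵥ ψ = x.2 • ψ) {x : List G.Dart × ℂ} (hx : x ∈ F) :
    M.fluxString x.1 * (F.map M.fluxFactor).prod = x.2 • (F.map M.fluxFactor).prod := by
  induction F with
  | nil => simp at hx
  | cons y F ih =>
    rw [List.map_cons, List.prod_cons, ← mul_assoc]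
    rcases List.mem_cons.1 hx with rfl | hx'
    · obtain ⟨h1, h2⟩ := M.fluxString_eigenvalue hψ (h x List.mem_cons_self)
      rw [M.fluxString_mul_fluxFactor h1 h2, smul_mul_assoc]
    · rw [(M.commute_fluxFactor (M.commute_fluxString (hF x hx) y.1) y.2).eq, mul_assoc,
        ih (fun y hy => hF y (List.mem_cons_of_mem _ hy))
          (fun y hy => h y (List.mem_cons_of_mem _ hy)) hx', mul_smul_comm]

/-- The leading flux along an arbitrary cyclic `L` makes the induction close: expanding one factor
leaves the list `L` or appends the next cyclic list to it. -/
theorem trace_prod_fluxFactor_mul_eq_zero {F : List (List G.Dart × ℂ)}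
    (hF : ∀ x ∈ F, IsCyclic x.1) {A : Op G}
    (hA : ∀ L, IsCyclic L → (M.fluxString L * A).trace = 0) {L : List G.Dart} (hL : IsCyclic L) :
    (M.fluxString L * ((F.map M.fluxFactor).prod * A)).trace = 0 := by
  induction F generalizing L with
  | nil => simpa using hA L hL
  | cons x F ih =>
    have hF' : ∀ y ∈ F, IsCyclic y.1 := fun y hy => hF y (List.mem_cons_of_mem _ hy)
    have h1 := ih hF' hL
    have h2 := ih hF' (hL.append (hF x List.mem_cons_self))
    have h3 : M.fluxString (L ++ x.1) = M.fluxString L * M.fluxString x.1 := by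
      simp only [fluxString, List.map_append, List.prod_append]
    rw [h3] at h2
    rw [List.map_cons, List.prod_cons, fluxFactor, smul_mul_assoc, smul_mul_assoc, mul_smul_comm,
      Matrix.trace_smul, add_mul, add_mul, one_mul, mul_add, Matrix.trace_add, h1, smul_mul_assoc,
      smul_mul_assoc, mul_smul_comm, Matrix.trace_smul, mul_assoc (M.fluxString x.1), ← mul_assoc, h2,
      smul_zero, add_zero, smul_zero]

/-! ### The steady state of a flux sector -/

section Sectors

variable (R : RotationSystem G) (holes : Set R.Face) {n : ℕ} {base : Fin n → V}
  (l : ∀ a, G.Walk (base a) (base a)) (w : R.Plaquette holes → ℂ) (w' : Fin n → ℂ)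

/-- The closed walks and plaquette boundaries with their flux eigenvalues. -/
noncomputable def sectorData : List (List G.Dart × ℂ) :=
  (List.ofFn fun a => ((l a).darts, w' a)) ++
    (Finset.univ : Finset (R.Plaquette holes)).toList.map fun p => (R.faceBoundary p.1, w p)

theorem sectorProjector_eq :
    M.sectorProjector R holes l w w' = ((sectorData R holes l w w').map M.fluxFactor).prod := by
  rw [sectorData, List.map_append, List.prod_append, List.map_ofFn, List.map_map]
  rfl

omit [DecidableEq V] [DecidableRel G.Adj] in
theorem mem_sectorData {x : List G.Dart × ℂ} :
    x ∈ sectorData R holes l w w' ↔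
      (∃ a, ((l a).darts, w' a) = x) ∨ ∃ p : R.Plaquette holes, (R.faceBoundary p.1, w p) = x := by
  simp [sectorData, List.mem_ofFn']

omit [DecidableEq V] [DecidableRel G.Adj] in
theorem isCyclic_of_mem_sectorData {x : List G.Dart × ℂ} (hx : x ∈ sectorData R holes l w w') :
    IsCyclic x.1 := by
  rcases (mem_sectorData R holes l w w').1 hx with ⟨a, rfl⟩ | ⟨p, rfl⟩
  · exact isCyclic_darts _
  · exact isCyclic_faceBoundary R _

variable {R holes l w w'}

theorem commute_sectorProjector {A : Op G} (hA : ∀ L, IsCyclic L → Commute A (M.fluxString L)) :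
    Commute A (M.sectorProjector R holes l w w') := by
  rw [sectorProjector_eq]
  exact M.commute_prod_fluxFactor fun x hx => hA _ (isCyclic_of_mem_sectorData _ _ _ _ _ hx)

theorem commute_steadyState {A : Op G} (hA : Commute A (M.sectorProjector R holes l w w')) :
    Commute A (M.steadyState R holes l w w') := hA.smul_right _

theorem eigenvector_sectorData {ψ : Conf G → ℂ}
    (h : (∀ p, M.plaquetteFlux R holes p *ᵥ ψ = w p • ψ) ∧
      ∀ a, M.logicalX l a *ᵥ ψ = w' a • ψ) :
    ∀ x ∈ sectorData R holes l w w', M.fluxString x.1 *ᵥ ψ = x.2 • ψ := by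
  intro x hx
  rcases (mem_sectorData R holes l w w').1 hx with ⟨a, rfl⟩ | ⟨p, rfl⟩
  · exact h.2 a
  · exact h.1 p

theorem isStarProjection_sectorProjector (h : M.IsFluxConfig R holes l w w') :
    IsStarProjection (M.sectorProjector R holes l w w') := by
  obtain ⟨ψ, hψ, h⟩ := h
  rw [sectorProjector_eq]
  exact M.isStarProjection_prod_fluxFactor
    (fun x hx => isCyclic_of_mem_sectorData _ _ _ _ _ hx) hψ (M.eigenvector_sectorData h)

theorem sectorProjector_ne_zero (h : M.IsFluxConfig R holes l w w') :
    M.sectorProjector R holes l w w' ≠ 0 := by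
  obtain ⟨ψ, hψ, h⟩ := h
  intro h0
  have := M.prod_fluxFactor_mulVec hψ (M.eigenvector_sectorData h)
  rw [← sectorProjector_eq, h0, Matrix.zero_mulVec] at this
  exact hψ this.symm

theorem posSemidef_sectorProjector (h : M.IsFluxConfig R holes l w w') :
    (M.sectorProjector R holes l w w').PosSemidef := by
  have hP := M.isStarProjection_sectorProjector h
  have h1 := Matrix.posSemidef_conjTranspose_mul_self (M.sectorProjector R holes l w w')
  rwa [← Matrix.star_eq_conjTranspose, hP.isSelfAdjoint.star_eq, hP.isIdempotentElem.eq] at h1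

theorem trace_sectorProjector_ne_zero (h : M.IsFluxConfig R holes l w w') :
    (M.sectorProjector R holes l w w').trace ≠ 0 := fun h0 =>
  M.sectorProjector_ne_zero h ((M.posSemidef_sectorProjector h).trace_eq_zero_iff.1 h0)

theorem posSemidef_steadyState (h : M.IsFluxConfig R holes l w w') :
    (M.steadyState R holes l w w').PosSemidef := by
  have hP := M.posSemidef_sectorProjector h
  refine hP.smul ?_
  obtain ⟨h1, h2⟩ := Complex.nonneg_iff.1 hP.trace_nonneg
  rw [show (M.sectorProjector R holes l w w').trace =
    ((M.sectorProjector R holes l w w').trace.re : ℂ) from Complex.ext rfl h2.symm,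
    ← Complex.ofReal_inv]
  exact Complex.zero_le_real.2 (inv_nonneg.2 h1)

theorem trace_steadyState (h : M.IsFluxConfig R holes l w w') :
    (M.steadyState R holes l w w').trace = 1 := by
  rw [steadyState, Matrix.trace_smul, smul_eq_mul,
    inv_mul_cancel₀ (M.trace_sectorProjector_ne_zero h)]

theorem trace_steadyState_mul_self_ne_zero (h : M.IsFluxConfig R holes l w w') :
    (M.steadyState R holes l w w' * M.steadyState R holes l w w').trace ≠ 0 := by
  rw [steadyState, smul_mul_smul_comm, (M.isStarProjection_sectorProjector h).isIdempotentElem.eq,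
    Matrix.trace_smul]
  have h1 := M.trace_sectorProjector_ne_zero h
  exact smul_ne_zero (mul_ne_zero (inv_ne_zero h1) (inv_ne_zero h1)) h1

/-- Each jump operator is a multiple of a unitary, so once it commutes with `ρ` the gain and loss
terms are the same multiple of `ρ` and cancel. -/
theorem lindbladian_eq_zero {ρ : Op G} (J : Sym2 V → ℝ) (γ : V → ℝ)
    (hH : Commute (M.hamiltonian J) ρ) (hJ : ∀ j, Commute (M.jump γ j) ρ) :
    M.lindbladian J γ ρ = 0 := by
  have h1 : ∀ j, ∃ c : ℂ, M.jump γ j * (M.jump γ j)ᴴ = c • 1 ∧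
      (M.jump γ j)ᴴ * M.jump γ j = c • 1 := by
    intro j
    refine ⟨(Real.sqrt (γ j) : ℂ) * star (Real.sqrt (γ j) : ℂ), ?_, ?_⟩
    · rw [jump, Matrix.conjTranspose_smul, smul_mul_smul_comm, ← Matrix.star_eq_conjTranspose,
        Matrix.mem_unitaryGroup_iff.1 (M.chiral_mem_unitary j)]
    · rw [jump, Matrix.conjTranspose_smul, smul_mul_smul_comm, ← Matrix.star_eq_conjTranspose,
        Matrix.mem_unitaryGroup_iff'.1 (M.chiral_mem_unitary j), mul_comm]
  rw [lindbladian, hH.eq, sub_self, smul_zero, neg_zero, zero_add]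
  refine Finset.sum_eq_zero fun j _ => ?_
  obtain ⟨c, h2, h3⟩ := h1 j
  rw [(hJ j).eq, mul_assoc, h2, h3, mul_smul_comm, smul_mul_assoc, mul_one, one_mul]
  module

theorem logicalX_mul_steadyState (h : M.IsFluxConfig R holes l w w') (a : Fin n) :
    M.logicalX l a * M.steadyState R holes l w w' = w' a • M.steadyState R holes l w w' := by
  obtain ⟨ψ, hψ, h⟩ := h
  have hx : ((l a).darts, w' a) ∈ sectorData R holes l w w' :=
    (mem_sectorData R holes l w w').2 (Or.inl ⟨a, rfl⟩)
  have h1 := M.fluxString_mul_prod_fluxFactor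
    (fun x hx => isCyclic_of_mem_sectorData _ _ _ _ _ hx) hψ (M.eigenvector_sectorData h) hx
  rw [← sectorProjector_eq] at h1
  change M.logicalX l a * _ = _ at h1
  rw [steadyState, mul_smul_comm, h1, smul_comm]

theorem trace_steadyState_mul_dualOp_eq_zero {s t : DualString G} (h : ¬ DifferByFlux s t) :
    (M.steadyState R holes l w w' * M.dualOp s * M.dualOp t).trace = 0 := by
  have h1 : ∀ L, IsCyclic L → (M.fluxString L * (M.dualOp s * M.dualOp t)).trace = 0 :=
    fun L hL => by_contra fun h0 => h (M.differByFlux_of_trace_ne_zero hL s t h0)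
  have h2 := M.trace_prod_fluxFactor_mul_eq_zero
    (fun x hx => isCyclic_of_mem_sectorData R holes l w w' hx) h1 IsCyclic.nil
  rw [← sectorProjector_eq, show M.fluxString [] = 1 from rfl, one_mul] at h2
  rw [mul_assoc, steadyState, smul_mul_assoc, Matrix.trace_smul, h2, smul_zero]

/-- Two dual strings that cross every closed walk of the sector equally often modulo two multiply to
an operator that commutes with the steady state. -/
theorem commute_dualOp_mul_steadyState {s t : DualString G}
    (hs : R.IsDualPath holes s.path) (ht : R.IsDualPath holes t.path)
    (h : ∀ a, Even (crossings (l a).darts s.path) ↔ Even (crossings (l a).darts t.path)) :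
    Commute (M.dualOp s * M.dualOp t) (M.steadyState R holes l w w') := by
  refine M.commute_steadyState ?_
  rw [sectorProjector_eq]
  refine M.commute_prod_fluxFactor fun x hx => ?_
  have hc := isCyclic_of_mem_sectorData _ _ _ _ _ hx
  refine (((M.signCommute_fluxString_dualOp hc s).mul_right
    (M.signCommute_fluxString_dualOp hc t)).commute ?_).symm
  rw [Nat.even_add]
  rcases (mem_sectorData R holes l w w').1 hx with ⟨a, rfl⟩ | ⟨p, rfl⟩
  · exact h a
  · exact iff_of_true (even_crossings_faceBoundary R hs p.2) (even_crossings_faceBoundary R ht p.2)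

end Sectors

end Model

/-- Conjugating one of two factors by a commuting unitary does not change the trace of the
product. -/
theorem trace_mul_conj_unitary {n : Type*} [Fintype n] [DecidableEq n] {U ρ : Matrix n n ℂ}
    (hU : U ∈ Matrix.unitaryGroup n ℂ) (h : Commute U ρ) :
    (ρ * U * ρ * Uᴴ).trace = (ρ * ρ).trace := by
  rw [mul_assoc ρ U ρ, h.eq, ← mul_assoc, mul_assoc, ← Matrix.star_eq_conjTranspose,
    Matrix.mem_unitaryGroup_iff.1 hU, mul_one]

namespace Model

variable {V : Type*} [Fintype V] [DecidableEq V] {G : SimpleGraph V} [DecidableRel G.Adj]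
  (M : Model G)

theorem conj_logicalX_dualOp {n : ℕ} {base : Fin n → V} (l : ∀ a, G.Walk (base a) (base a))
    {a : Fin n} {s : DualString G} (h : Odd (crossings (l a).darts s.path)) :
    (M.logicalX l a)ᴴ * M.dualOp s * M.logicalX l a = -M.dualOp s := by
  have h1 := (M.signCommute_fluxString_dualOp (isCyclic_darts (l a)) s).symm.anticommute h
  change _ * M.fluxString _ = -(M.fluxString _ * _) at h1
  rw [logicalX, mul_assoc, h1, mul_neg, ← mul_assoc, ← Matrix.star_eq_conjTranspose,
    Matrix.mem_unitaryGroup_iff'.1 (M.fluxString_mem_unitary _), one_mul]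

end Model

end GammaMatrix

/-! ### Logical algebra, steady states and correlators -/

theorem mainTheorem3 {V : Type*} [Fintype V] [DecidableEq V] [Nontrivial V]
    (G : SimpleGraph V) [DecidableRel G.Adj] (hG : G.Connected)
    (R : GammaMatrix.RotationSystem G) (holes : Set R.Face)
    (M : GammaMatrix.Model G) (J : Sym2 V → ℝ) (γ : V → ℝ) (hγ : ∀ j, 0 ≤ γ j)
    (base : Fin (R.bettiOne holes) → V) (l : ∀ a, G.Walk (base a) (base a))
    (lt : Fin (R.bettiOne holes) → GammaMatrix.DualString G)
    (hlt : ∀ a, R.IsDualPath holes (lt a).path)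
    (hint : ∀ a b, Odd (GammaMatrix.intersections (l a) (lt b)) ↔ a = b) :
    -- the algebra of the logical operators
    (∀ a b, Commute (M.logicalX l a) (M.logicalX l b)) ∧
    (∀ a b, M.dualOp (lt a) * M.dualOp (lt b) =
      (-1 : ℂ) ^ GammaMatrix.clashes (lt a) (lt b) • (M.dualOp (lt b) * M.dualOp (lt a))) ∧
    (∀ a b, M.logicalX l a * M.dualOp (lt b) =
      (if a = b then (-1 : ℂ) else 1) • (M.dualOp (lt b) * M.logicalX l a)) ∧
    -- the noncontractible fluxes are strong symmetries of the dynamics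
    (∀ a, M.logicalX l a ∈ Matrix.unitaryGroup (GammaMatrix.Conf G) ℂ ∧
      Commute (M.logicalX l a) (M.hamiltonian J) ∧
      ∀ j, Commute (M.logicalX l a) (M.jump γ j) ∧ Commute (M.logicalX l a) (M.jump γ j)ᴴ) ∧
    -- the steady states
    ∀ (w : R.Plaquette holes → ℂ) (w' : Fin (R.bettiOne holes) → ℂ),
      M.IsFluxConfig R holes l w w' →
      let ρ := M.steadyState R holes l w w'
      ρ.PosSemidef ∧ ρ.trace = 1 ∧ M.lindbladian J γ ρ = 0 ∧
      ∀ a, M.logicalX l a * ρ = w' a • ρ ∧ ρ * M.logicalX l a = w' a • ρ ∧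
        ∀ (x y : V) (sx sy : GammaMatrix.DualString G), x ≠ y →
          sx.PassesThrough x → sy.PassesThrough y →
          R.DualDeformable holes (lt a).path sx.path →
          R.DualDeformable holes (lt a).path sy.path →
          let Zx := M.dualOp sx
          let Zy := M.dualOp sy
          -- the operators are charged under the noncontractible flux
          (M.logicalX l a)ᴴ * Zx * M.logicalX l a = -Zx ∧
          (M.logicalX l a)ᴴ * Zy * M.logicalX l a = -Zy ∧
          -- the correlators
          (¬ GammaMatrix.DifferByFlux sx sy → (ρ * Zx * Zy).trace = 0) ∧
          (ρ * Zx * Zy * ρ * Zyᴴ * Zxᴴ).trace / (ρ * ρ).trace = 1 ∧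
          -- without adjoints, for phases that make the operators Hermitian
          (∀ θ η : ℂ, ‖θ‖ = 1 → ‖η‖ = 1 → (θ • Zx).IsHermitian → (η • Zy).IsHermitian →
            (ρ * (θ • Zx) * (η • Zy) * ρ * (η • Zy) * (θ • Zx)).trace / (ρ * ρ).trace = 1) := by
  have hpar : ∀ a b, Odd (GammaMatrix.crossings (l a).darts (lt b).path) ↔ a = b := fun a b => by
    rw [← GammaMatrix.intersections_eq_crossings, hint]
  have hcyc := fun a => GammaMatrix.isCyclic_darts (l a)
  have hX : ∀ a, M.logicalX l a = M.fluxString (l a).darts := fun _ => rfl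
  refine ⟨fun a b => M.commute_fluxString (hcyc a) _, fun a b => M.signCommute_dualOp _ _,
    fun a b => ?_, fun a => ⟨M.fluxString_mem_unitary _, M.commute_fluxString_hamiltonian (hcyc a) J,
      fun j => ⟨M.commute_fluxString_jump (hcyc a) γ j, ?_⟩⟩, ?_⟩
  · have h := M.signCommute_fluxString_dualOp (hcyc a) (lt b)
    by_cases hab : a = b
    · rw [if_pos hab, neg_one_smul]
      exact h.anticommute ((hpar a b).2 hab)
    · rw [if_neg hab, one_smul]
      exact h.commute (Nat.not_odd_iff_even.1 fun ho => hab ((hpar a b).1 ho))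
  · rw [GammaMatrix.Model.jump, Matrix.conjTranspose_smul]
    refine Commute.smul_right ?_ _
    have hc := (M.signCommute_fluxString_chiral (l a).darts j).commute (hcyc a j)
    have hU := M.chiral_mem_unitary j
    -- The adjoint of the chiral element is its inverse, so commutation passes to it.
    rw [← Matrix.star_eq_conjTranspose, hX]
    calc M.fluxString (l a).darts * star (M.chiral j)
        = star (M.chiral j) * M.chiral j * M.fluxString (l a).darts * star (M.chiral j) := by
          rw [Matrix.mem_unitaryGroup_iff'.1 hU, one_mul]
      _ = star (M.chiral j) * M.fluxString (l a).darts := by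
          rw [mul_assoc (star _), ← hc.eq, mul_assoc, mul_assoc, Matrix.mem_unitaryGroup_iff.1 hU,
            mul_one]
  intro w w' hw ρ
  have hcomm : ∀ A, (∀ L, GammaMatrix.IsCyclic L → Commute A (M.fluxString L)) → Commute A ρ :=
    fun A hA => M.commute_steadyState (M.commute_sectorProjector hA)
  refine ⟨M.posSemidef_steadyState hw, M.trace_steadyState hw, M.lindbladian_eq_zero J γ
    (hcomm _ fun L hL => (M.commute_fluxString_hamiltonian hL J).symm)
    (fun j => hcomm _ fun L hL => (M.commute_fluxString_jump hL γ j).symm), fun a => ?_⟩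
  have hXρ : M.logicalX l a * ρ = w' a • ρ := M.logicalX_mul_steadyState hw a
  refine ⟨hXρ, ?_, ?_⟩
  · rw [← (hcomm _ fun L _ => M.commute_fluxString (hcyc a) L : Commute (M.logicalX l a) ρ).eq, hXρ]
  intro x y sx sy _ _ _ hdx hdy Zx Zy
  have hx : ∀ b, Odd (GammaMatrix.crossings (l b).darts sx.path) ↔ b = a := fun b => by
    rw [← hpar b a, ← Nat.not_even_iff_odd, ← Nat.not_even_iff_odd,
      GammaMatrix.even_crossings_iff_of_deformable R (hcyc b) hdx]
  have hy : ∀ b, Odd (GammaMatrix.crossings (l b).darts sy.path) ↔ b = a := fun b => by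
    rw [← hpar b a, ← Nat.not_even_iff_odd, ← Nat.not_even_iff_odd,
      GammaMatrix.even_crossings_iff_of_deformable R (hcyc b) hdy]
  -- Each string alone anticommutes with the `a`-th flux; in the product the two signs cancel.
  have hQ : Commute (Zx * Zy) ρ := M.commute_dualOp_mul_steadyState
    ((GammaMatrix.isDualPath_iff_of_deformable R hdx).1 (hlt a))
    ((GammaMatrix.isDualPath_iff_of_deformable R hdy).1 (hlt a))
    fun b => by rw [← Nat.not_odd_iff_even, ← Nat.not_odd_iff_even, hx b, hy b]
  have hQU : Zx * Zy ∈ Matrix.unitaryGroup (GammaMatrix.Conf G) ℂ :=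
    mul_mem (M.dualOp_mem_unitary sx) (M.dualOp_mem_unitary sy)
  have hne : (ρ * ρ).trace ≠ 0 := M.trace_steadyState_mul_self_ne_zero hw
  refine ⟨M.conj_logicalX_dualOp l ((hx a).2 rfl), M.conj_logicalX_dualOp l ((hy a).2 rfl),
    fun h => M.trace_steadyState_mul_dualOp_eq_zero h, ?_, ?_⟩
  · rw [mul_assoc _ Zyᴴ, ← Matrix.conjTranspose_mul, mul_assoc ρ Zx,
      GammaMatrix.trace_mul_conj_unitary hQU hQ, div_self hne]
  · intro θ η hθ hη hθZ hηZ
    -- The rephased product is again a unitary commuting with `ρ`, and Hermiticity of the factors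
    -- turns its adjoint into the same factors in reverse order.
    have h1 : (θ * η) • (Zx * Zy) = (θ • Zx) * (η • Zy) := by rw [smul_mul_smul_comm]
    have h2 := GammaMatrix.trace_mul_conj_unitary
      (GammaMatrix.smul_mem_unitaryGroup (by rw [norm_mul, hθ, hη, one_mul] : ‖θ * η‖ = 1) hQU)
      (hQ.smul_left (θ * η))
    rw [h1, Matrix.conjTranspose_mul, hθZ.eq, hηZ.eq] at h2
    rw [mul_assoc _ (η • Zy) (θ • Zx), mul_assoc ρ (θ • Zx), h2, div_self hne]
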